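/- Let $q$ be an odd prime power and let $G\le\mathrm{AGL}(2,q)$ be the group of all permutations $v\mapsto Av+b$ of $\Omega=\mathbb F_q^2$, where $b\in\mathbb F_q^2$ and $A$ runs over all monomial $2\times 2$ matrices over $\mathbb F_q$ (exactly one nonzero entry in each row and each column) with $\det A=\pm1$. Let $\mathcal X=\mathrm{Inv}(G)$ be the Passman scheme of degree $q^2$, i.e. the coherent configuration on $\Omega$ whose basis relations are the orbits of $G$ on $\Omega\times\Omega$. For $\alpha_1,\dots,\alpha_m\in\Omega$, let the point extension $\mathcal X_{\alpha_1,\dots,\alpha_m}$ be the smallest (coarsest) coherent configuration on $\Omega$ for which every basis relation of $\mathcal X$ and each of the relations $\{(\alpha_i,\alpha_i)\}$ is a union of basis relations. Then, for every set $\{\alpha_1,\dots,\alpha_m\}$ of at least two distinct points of $\Omega$, the coherent configuration $\mathcal X_{\alpha_1,\dots,\alpha_m}$ is partly regular: there is a point $\alpha\in\Omega$ such that for every basis relation $s$ of $\mathcal X_{\alpha_1,\dots,\alpha_m}$ there is at most one $\beta\in\Omega$ with $(\alpha,\beta)\in s$. Here a coherent configuration on a finite set $\Omega$ is a partition $S$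 of $\Omega\times\Omega$ (its members are the basis relations) such that the diagonal is a union of members of $S$, the converse $s^*=\{(\beta,\alpha):(\alpha,\beta)\in s\}$ of every $s\in S$ belongs to $S$, and for all $r,s,t\in S$ the number of $\gamma\in\Omega$ with $(\alpha,\gamma)\in r$ and $(\gamma,\beta)\in s$ does not depend on the choice of $(\alpha,\beta)\in t$. -/

import Mathlib

/-! Binary relations on `Ω` are subsets of `Ω × Ω`. -/

/-- The converse relation `r* = {(β, α) : (α, β) ∈ r}`. -/
def conv {Ω : Type*} (r : Set (Ω × Ω)) : Set (Ω × Ω) := {p | (p.2, p.1) ∈ r}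

/-- The neighbourhood `α r = {β : (α, β) ∈ r}`. -/
def nbhd {Ω : Type*} (α : Ω) (r : Set (Ω × Ω)) : Set Ω := {β | (α, β) ∈ r}

/-- `S^∪`: the set of all unions of members of `S`. -/
def unions {P : Type*} (S : Set (Set P)) : Set (Set P) := {r | ∃ U ⊆ S, r = ⋃₀ U}

/-- A rainbow on `Ω`: a partition of `Ω × Ω` for which the diagonal is a union of classes and
which is closed under taking converses. -/
structure Rainbow (Ω : Type*) [Finite Ω] where
  /-- the set of basis relations -/
  basis : Set (Set (Ω × Ω))
  isPartition : Setoid.IsPartition basis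
  diagonal_mem : Set.diagonal Ω ∈ unions basis
  conv_basis : conv '' basis = basis

/-- A coherent configuration: a rainbow such that for basis relations `r`, `s`, `t` the number
`|α r ∩ β s*|` does not depend on the choice of `(α, β) ∈ t`. -/
structure CoherentConfiguration (Ω : Type*) [Finite Ω] extends Rainbow Ω where
  coherent : ∀ r ∈ basis, ∀ s ∈ basis, ∀ t ∈ basis, ∀ p ∈ t, ∀ p' ∈ t,
    (nbhd p.1 r ∩ nbhd p.2 (conv s)).ncard = (nbhd p'.1 r ∩ nbhd p'.2 (conv s)).ncard

theorem mem_unions_classes {P : Type*} (c : Setoid P) (r : Set P) :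
    r ∈ unions c.classes ↔ ∀ p p', c p p' → p ∈ r → p' ∈ r := by
  constructor
  · rintro ⟨U, hU, rfl⟩ p p' h ⟨u, hu, hp⟩
    obtain ⟨z, rfl⟩ := hU hu
    exact ⟨_, hu, c.trans (c.symm h) hp⟩
  · intro h
    refine ⟨{u | u ∈ c.classes ∧ u ⊆ r}, fun u hu => hu.1, ?_⟩
    ext p
    constructor
    · intro hp
      exact ⟨{x | c x p}, ⟨⟨p, rfl⟩, fun x hx => h p x (c.symm hx) hp⟩, c.refl p⟩
    · rintro ⟨u, hu, hp⟩
      exact hu.2 hp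

namespace Rainbow

/-- The equivalence relation on `Ω × Ω` whose classes are the basis relations. -/
def setoid {Ω : Type*} [Finite Ω] (X : Rainbow Ω) : Setoid (Ω × Ω) :=
  Setoid.mkClasses X.basis X.isPartition.2

theorem classes_setoid {Ω : Type*} [Finite Ω] (X : Rainbow Ω) : X.setoid.classes = X.basis :=
  Setoid.classes_mkClasses X.basis X.isPartition

theorem mem_unions {Ω : Type*} [Finite Ω] (X : Rainbow Ω) (r : Set (Ω × Ω)) :
    r ∈ unions X.basis ↔ ∀ p p', X.setoid p p' → p ∈ r → p' ∈ r := by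
  rw [← classes_setoid, mem_unions_classes]

end Rainbow

namespace CoherentConfiguration

/-- Builds a coherent configuration from the equivalence relation on `Ω × Ω` whose classes are
the basis relations. -/
def ofSetoid {Ω : Type*} [Finite Ω] (c : Setoid (Ω × Ω))
    (hdiag : ∀ α p, c (α, α) p → p.1 = p.2)
    (hconv : ∀ p p', c p p' → c p.swap p'.swap)
    (hcoh : ∀ r ∈ c.classes, ∀ s ∈ c.classes, ∀ p p', c p p' →
      (nbhd p.1 r ∩ nbhd p.2 (conv s)).ncard = (nbhd p'.1 r ∩ nbhd p'.2 (conv s)).ncard) :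
    CoherentConfiguration Ω where
  basis := c.classes
  isPartition := c.isPartition_classes
  diagonal_mem := by
    rw [mem_unions_classes]
    rintro ⟨a, b⟩ p' h hab
    obtain rfl : a = b := hab
    exact hdiag a p' h
  conv_basis := by
    have key : ∀ q : Ω × Ω, conv {x | c x q} = {x | c x q.swap} := by
      intro q
      ext x
      exact ⟨fun h => hconv x.swap q h, fun h => hconv x q.swap h⟩
    ext r
    constructor
    · rintro ⟨_, ⟨q, rfl⟩, rfl⟩
      exact ⟨q.swap, key q⟩
    · rintro ⟨q, rfl⟩
      exact ⟨_, ⟨q.swap, rfl⟩, key q.swap⟩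
  coherent := by
    rintro r hr s hs t ⟨q, rfl⟩ p hp p' hp'
    exact hcoh r hr s hs p p' (c.trans hp (c.symm hp'))

/-- `X ≤ Y` if every relation of `X` is a relation of `Y`. -/
instance {Ω : Type*} [Finite Ω] : PartialOrder (CoherentConfiguration Ω) where
  le X Y := unions X.basis ⊆ unions Y.basis
  le_refl _ := subset_rfl
  le_trans _ _ _ h h' := subset_trans h h'
  le_antisymm X Y h h' := by
    have key : ∀ X Y : CoherentConfiguration Ω, unions X.basis ⊆ unions Y.basis →
        ∀ p p', Y.setoid p p' → X.setoid p p' := by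
      intro X Y h p p' hp
      have h1 : {x | X.setoid x p} ∈ unions X.basis := by
        rw [X.mem_unions]
        intro a b hab ha
        exact X.setoid.trans (X.setoid.symm hab) ha
      have h2 := (Y.mem_unions _).1 (h h1) p p' hp (X.setoid.refl p)
      exact X.setoid.symm h2
    have hs : X.setoid = Y.setoid :=
      Setoid.ext fun p p' => ⟨key Y X h' p p', key X Y h p p'⟩
    have hb : X.basis = Y.basis := by
      rw [← X.classes_setoid, ← Y.classes_setoid, hs]
    obtain ⟨⟨b, _, _, _⟩, _⟩ := X
    obtain ⟨⟨b', _, _, _⟩, _⟩ := Y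
    obtain rfl : b = b' := hb
    rfl

/-- The coherent configuration `Inv(G)` of a permutation group `G`: its basis relations are the
orbits of `G` on `Ω × Ω`. -/
def inv {Ω : Type*} [Finite Ω] (G : Subgroup (Equiv.Perm Ω)) : CoherentConfiguration Ω where
  basis := Set.range fun p : Ω × Ω => MulAction.orbit G p
  isPartition := by
    have h : Set.range (fun p : Ω × Ω => MulAction.orbit G p)
        = (MulAction.orbitRel G (Ω × Ω)).classes := by
      ext r
      exact ⟨fun ⟨p, hp⟩ => ⟨p, hp.symm⟩, fun ⟨p, hp⟩ => ⟨p, hp.symm⟩⟩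
    rw [h]
    exact Setoid.isPartition_classes _
  diagonal_mem := by
    refine ⟨{u | ∃ α : Ω, u = MulAction.orbit G (α, α)}, ?_, ?_⟩
    · rintro _ ⟨α, rfl⟩
      exact ⟨_, rfl⟩
    · ext ⟨a, b⟩
      constructor
      · intro h
        obtain rfl : a = b := h
        exact ⟨_, ⟨a, rfl⟩, MulAction.mem_orbit_self _⟩
      · rintro ⟨_, ⟨α, rfl⟩, ⟨g, hg⟩⟩
        have h1 : g • α = a := congrArg Prod.fst hg
        have h2 : g • α = b := congrArg Prod.snd hg
        exact h1.symm.trans h2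
  conv_basis := by
    have key : ∀ q : Ω × Ω, conv (MulAction.orbit G q) = MulAction.orbit G q.swap := by
      intro q
      ext x
      constructor
      · rintro ⟨g, hg⟩
        exact ⟨g, Prod.ext (congrArg Prod.snd hg) (congrArg Prod.fst hg)⟩
      · rintro ⟨g, hg⟩
        exact ⟨g, Prod.ext (congrArg Prod.snd hg) (congrArg Prod.fst hg)⟩
    ext r
    constructor
    · rintro ⟨_, ⟨q, rfl⟩, rfl⟩
      exact ⟨q.swap, (key q).symm⟩
    · rintro ⟨q, rfl⟩
      exact ⟨_, ⟨q.swap, rfl⟩, key q.swap⟩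
  coherent := by
    have step : ∀ (u v x : Ω × Ω) (g : G),
        (nbhd x.1 (MulAction.orbit G u) ∩ nbhd x.2 (conv (MulAction.orbit G v))).ncard
          ≤ (nbhd (g • x).1 (MulAction.orbit G u)
            ∩ nbhd (g • x).2 (conv (MulAction.orbit G v))).ncard := by
      intro u v x g
      refine Set.ncard_le_ncard_of_injOn (fun γ => g • γ) ?_
        (fun a _ b _ h => MulAction.injective g h) (Set.toFinite _)
      rintro γ ⟨h1, h2⟩
      exact ⟨(MulAction.mem_orbit_of_mem_orbit g h1 : g • (x.1, γ) ∈ _),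
        (MulAction.mem_orbit_of_mem_orbit g h2 : g • (γ, x.2) ∈ _)⟩
    rintro _ ⟨u, rfl⟩ _ ⟨v, rfl⟩ _ ⟨w, rfl⟩ p hp p' hp'
    obtain ⟨g, rfl⟩ := hp
    obtain ⟨g', rfl⟩ := hp'
    apply le_antisymm
    · simpa [smul_smul] using step u v (g • w) (g' * g⁻¹)
    · simpa [smul_smul] using step u v (g' • w) (g * g'⁻¹)

/-- The equivalence relation on `Ω × Ω` generated by the equivalence relations of all coherent
configurations that have all members of `T` among their relations. -/
def wlSetoid {Ω : Type*} [Finite Ω] (T : Set (Set (Ω × Ω))) : Setoid (Ω × Ω) :=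
  sSup {c | ∃ Y : CoherentConfiguration Ω, T ⊆ unions Y.basis ∧ c = Y.setoid}

theorem wlSetoid_le_iff {Ω : Type*} [Finite Ω] (T : Set (Set (Ω × Ω))) (d : Setoid (Ω × Ω)) :
    wlSetoid T ≤ d ↔
      ∀ Y : CoherentConfiguration Ω, T ⊆ unions Y.basis → Y.setoid ≤ d := by
  refine sSup_le_iff.trans ⟨fun h Y hY => h _ ⟨Y, hY, rfl⟩, ?_⟩
  rintro h _ ⟨Y, hY, rfl⟩
  exact h Y hY

theorem setoid_le_wlSetoid {Ω : Type*} [Finite Ω] (T : Set (Set (Ω × Ω)))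
    (Y : CoherentConfiguration Ω) (hY : T ⊆ unions Y.basis) : Y.setoid ≤ wlSetoid T :=
  (wlSetoid_le_iff T _).1 le_rfl Y hY

theorem setoid_swap {Ω : Type*} [Finite Ω] (Y : CoherentConfiguration Ω) (p p' : Ω × Ω)
    (h : Y.setoid p p') : Y.setoid p.swap p'.swap := by
  have h1 : {x | Y.setoid x p} ∈ Y.basis := by
    rw [← Y.classes_setoid]
    exact ⟨p, rfl⟩
  have h2 : conv {x | Y.setoid x p} ∈ Y.basis := by
    rw [← Y.conv_basis]
    exact ⟨_, h1, rfl⟩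
  rw [← Y.classes_setoid] at h2
  obtain ⟨z, hz⟩ := h2
  have h3 : p.swap ∈ conv {x | Y.setoid x p} := Y.setoid.refl p
  have h4 : p'.swap ∈ conv {x | Y.setoid x p} := Y.setoid.symm h
  rw [hz] at h3 h4
  exact Y.setoid.trans h3 (Y.setoid.symm h4)

/-- In a coherent configuration `|α r ∩ β s*|` is constant on basis relations also for arbitrary
relations `r` and `s`. -/
theorem coherent_unions {Ω : Type*} [Finite Ω] (Y : CoherentConfiguration Ω)
    (r s : Set (Ω × Ω)) (hr : r ∈ unions Y.basis) (hs : s ∈ unions Y.basis) (p p' : Ω × Ω)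
    (h : Y.setoid p p') :
    (nbhd p.1 r ∩ nbhd p.2 (conv s)).ncard = (nbhd p'.1 r ∩ nbhd p'.2 (conv s)).ncard := by
  classical
  have cls : ∀ q, {x | Y.setoid x q} ∈ Y.basis := fun q => by
    rw [← Y.classes_setoid]
    exact ⟨q, rfl⟩
  have := Fintype.ofFinite Ω
  let col : Ω × Ω → Ω → Quotient Y.setoid × Quotient Y.setoid :=
    fun x γ => (Quotient.mk Y.setoid (x.1, γ), Quotient.mk Y.setoid (γ, x.2))
  have := Fintype.ofFinite (Quotient Y.setoid)
  have fib : ∀ k, (Finset.univ.filter fun γ => col p γ = k).card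
      = (Finset.univ.filter fun γ => col p' γ = k).card := by
    rintro ⟨a, b⟩
    obtain ⟨u, rfl⟩ := Quotient.exists_rep a
    obtain ⟨v, rfl⟩ := Quotient.exists_rep b
    have e := Y.coherent _ (cls u) _ (cls v) _ (cls p) p (Y.setoid.refl p) p' (Y.setoid.symm h)
    have conv' : ∀ x : Ω × Ω, (nbhd x.1 {y | Y.setoid y u} ∩
        nbhd x.2 (conv {y | Y.setoid y v})).ncard
        = (Finset.univ.filter fun γ => col x γ = (⟦u⟧, ⟦v⟧)).card := by
      intro x
      rw [← Set.ncard_coe_finset]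
      congr 1
      ext γ
      simp only [Finset.coe_filter, Finset.mem_univ, true_and, Set.mem_ofPred_eq, col,
        Prod.mk.injEq, Quotient.eq]
      rfl
    rw [conv', conv'] at e
    exact e
  have tot : ∀ x : Ω × Ω, (nbhd x.1 r ∩ nbhd x.2 (conv s)).ncard
      = ∑ k : Quotient Y.setoid × Quotient Y.setoid,
        if k.1.out ∈ r ∧ k.2.out ∈ s then (Finset.univ.filter fun γ => col x γ = k).card
        else 0 := by
    intro x
    have m : ∀ w ∈ unions Y.basis, ∀ y, (Quotient.mk Y.setoid y).out ∈ w ↔ y ∈ w := by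
      intro w hw y
      have hy : Y.setoid (Quotient.mk Y.setoid y).out y := Quotient.mk_out y
      exact ⟨(Y.mem_unions w).1 hw _ _ hy, (Y.mem_unions w).1 hw _ _ (Y.setoid.symm hy)⟩
    have e : nbhd x.1 r ∩ nbhd x.2 (conv s)
        = ((Finset.univ.filter fun γ => (x.1, γ) ∈ r ∧ (γ, x.2) ∈ s : Finset Ω) : Set Ω) := by
      ext γ
      simp [nbhd, conv]
    rw [e, Set.ncard_coe_finset,
      Finset.card_eq_sum_card_fiberwise (f := col x) (t := Finset.univ) (by simp)]
    refine Finset.sum_congr rfl fun k _ => ?_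
    split_ifs with hk
    · congr 1
      ext γ
      simp only [Finset.mem_filter, Finset.mem_univ, true_and]
      refine ⟨fun h => h.2, fun h => ⟨?_, h⟩⟩
      subst h
      exact ⟨(m r hr _).1 hk.1, (m s hs _).1 hk.2⟩
    · rw [Finset.card_eq_zero, Finset.filter_eq_empty_iff]
      rintro γ hγ rfl
      simp only [Finset.mem_filter, Finset.mem_univ, true_and] at hγ
      exact hk ⟨(m r hr _).2 hγ.1, (m s hs _).2 hγ.2⟩
  rw [tot, tot]
  exact Finset.sum_congr rfl fun k _ => by rw [fib k]

/-- The coherent closure `WL(T)` of a set `T` of relations: the smallest coherent configuration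
for which all members of `T` are relations (see `isLeast_WL`). -/
def WL {Ω : Type*} [Finite Ω] (T : Set (Set (Ω × Ω))) : CoherentConfiguration Ω :=
  ofSetoid (wlSetoid T)
    (by
      let d : Setoid (Ω × Ω) :=
        ⟨fun p p' => (p.1 = p.2 ↔ p'.1 = p'.2), fun _ => Iff.rfl, fun h => h.symm,
          fun h h' => h.trans h'⟩
      have hd : wlSetoid T ≤ d := by
        rw [wlSetoid_le_iff]
        intro Y _ p p' h
        have hm := (Y.mem_unions _).1 Y.diagonal_mem
        exact ⟨fun hp => hm p p' h hp, fun hp => hm p' p (Y.setoid.symm h) hp⟩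
      intro α p h
      exact (hd h).1 rfl)
    (by
      have hd : wlSetoid T ≤ (wlSetoid T).comap Prod.swap := by
        rw [wlSetoid_le_iff]
        intro Y hY p p' h
        exact setoid_le_wlSetoid T Y hY (setoid_swap Y p p' h)
      intro p p' h
      exact hd h)
    (by
      intro r hr s hs p p' h
      have hu : ∀ w ∈ (wlSetoid T).classes, ∀ Y : CoherentConfiguration Ω,
          T ⊆ unions Y.basis → w ∈ unions Y.basis := by
        rintro _ ⟨q, rfl⟩ Y hY
        rw [Y.mem_unions]
        intro a b hab ha
        exact (wlSetoid T).trans ((wlSetoid T).symm (setoid_le_wlSetoid T Y hY hab)) ha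
      have hd : wlSetoid T ≤ Setoid.ker
          (fun p : Ω × Ω => (nbhd p.1 r ∩ nbhd p.2 (conv s)).ncard) := by
        rw [wlSetoid_le_iff]
        intro Y hY a b hab
        exact coherent_unions Y r s (hu r hr Y hY) (hu s hs Y hY) a b hab
      exact hd h)

theorem isLeast_WL {Ω : Type*} [Finite Ω] (T : Set (Set (Ω × Ω))) :
    IsLeast {Y : CoherentConfiguration Ω | T ⊆ unions Y.basis} (WL T) := by
  constructor
  · intro t ht
    change t ∈ unions (wlSetoid T).classes
    rw [mem_unions_classes]
    let d : Setoid (Ω × Ω) :=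
      ⟨fun p p' => (p ∈ t ↔ p' ∈ t), fun _ => Iff.rfl, fun h => h.symm, fun h h' => h.trans h'⟩
    have hd : wlSetoid T ≤ d := by
      rw [wlSetoid_le_iff]
      intro Y hY p p' h
      have hm := (Y.mem_unions _).1 (hY ht)
      exact ⟨hm p p' h, hm p' p (Y.setoid.symm h)⟩
    intro p p' h
    exact (hd h).1
  · intro Y hY w hw
    have hw' : w ∈ unions (wlSetoid T).classes := hw
    rw [mem_unions_classes] at hw'
    rw [Y.mem_unions]
    intro p p' h
    exact hw' p p' (setoid_le_wlSetoid T Y hY h)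

/-- The point extension of `X` with respect to the points of `A`: the coherent closure of the
basis relations of `X` together with the relations `1_α = {(α, α)}`, `α ∈ A`. -/
def pointExtension {Ω : Type*} [Finite Ω] (X : CoherentConfiguration Ω) (A : Set Ω) :
    CoherentConfiguration Ω :=
  WL (X.basis ∪ {r | ∃ α ∈ A, r = {(α, α)}})

/-- Partly regular: some point `α` satisfies `|α s| ≤ 1` for all basis relations `s`. -/
def IsPartlyRegular {Ω : Type*} [Finite Ω] (X : CoherentConfiguration Ω) : Prop :=
  ∃ α : Ω, ∀ s ∈ X.basis, (nbhd α s).ncard ≤ 1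

end CoherentConfiguration

/-- A monomial matrix: exactly one nonzero entry in each row and in each column. -/
def IsMonomial {ι F : Type*} [Zero F] (A : Matrix ι ι F) : Prop :=
  (∀ i, ∃! j, A i j ≠ 0) ∧ (∀ j, ∃! i, A i j ≠ 0)

theorem isMonomial_two_iff {F : Type*} [Zero F] (A : Matrix (Fin 2) (Fin 2) F) :
    IsMonomial A ↔ (A 0 1 = 0 ∧ A 1 0 = 0 ∧ A 0 0 ≠ 0 ∧ A 1 1 ≠ 0) ∨
      (A 0 0 = 0 ∧ A 1 1 = 0 ∧ A 0 1 ≠ 0 ∧ A 1 0 ≠ 0) := by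
  simp only [IsMonomial, ExistsUnique, Fin.forall_fin_two, Fin.exists_fin_two]
  by_cases h1 : A 0 0 = 0 <;> by_cases h2 : A 0 1 = 0 <;> by_cases h3 : A 1 0 = 0 <;>
    by_cases h4 : A 1 1 = 0 <;> simp [h1, h2, h3, h4]

/-- The group of permutations `v ↦ A v + b` of `F²`, where `A` runs over the monomial matrices of
determinant `±1` and `b` over all vectors. -/
def passmanGroup (F : Type*) [Field F] : Subgroup (Equiv.Perm (Fin 2 → F)) where
  carrier := {g | ∃ (A : Matrix (Fin 2) (Fin 2) F) (b : Fin 2 → F),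
    IsMonomial A ∧ (A.det = 1 ∨ A.det = -1) ∧ ∀ v, g v = A.mulVec v + b}
  one_mem' := by
    refine ⟨1, 0, ?_, Or.inl Matrix.det_one, fun v => by simp⟩
    rw [isMonomial_two_iff]
    simp
  mul_mem' := by
    rintro g h ⟨A, b, hA, hdA, hg⟩ ⟨B, c, hB, hdB, hh⟩
    refine ⟨A * B, A.mulVec c + b, ?_, ?_, fun v => ?_⟩
    · rw [isMonomial_two_iff] at *
      simp only [Matrix.mul_apply, Fin.sum_univ_two]
      rcases hA with ⟨a1, a2, a3, a4⟩ | ⟨a1, a2, a3, a4⟩ <;>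
        rcases hB with ⟨b1, b2, b3, b4⟩ | ⟨b1, b2, b3, b4⟩ <;>
        simp [a1, a2, a3, a4, b1, b2, b3, b4]
    · rw [Matrix.det_mul]
      rcases hdA with h1 | h1 <;> rcases hdB with h2 | h2 <;> simp [h1, h2]
    · rw [Equiv.Perm.mul_apply, hh, hg, Matrix.mulVec_add, Matrix.mulVec_mulVec, add_assoc]
  inv_mem' := by
    rintro g ⟨A, b, hA, hdA, hg⟩
    have hu : IsUnit A.det := by
      rcases hdA with h1 | h1 <;> simp [h1]
    have hinv : A⁻¹ = A.det⁻¹ • !![A 1 1, -A 0 1; -A 1 0, A 0 0] := by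
      rw [Matrix.inv_def, Matrix.adjugate_fin_two, Ring.inverse_eq_inv']
    have hne : A.det ≠ 0 := hu.ne_zero
    refine ⟨A⁻¹, -(A⁻¹.mulVec b), ?_, ?_, fun v => ?_⟩
    · rw [isMonomial_two_iff] at *
      rw [hinv]
      rcases hA with ⟨a1, a2, a3, a4⟩ | ⟨a1, a2, a3, a4⟩ <;> simp [a1, a2, a3, a4, hne]
    · rw [Matrix.det_nonsing_inv, Ring.inverse_eq_inv']
      rcases hdA with h1 | h1
      · simp [h1]
      · right
        rw [h1]
        norm_num
    · rw [Equiv.Perm.inv_eq_iff_eq, hg, Matrix.mulVec_add, Matrix.mulVec_neg,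
        Matrix.mulVec_mulVec, Matrix.mulVec_mulVec, Matrix.mul_nonsing_inv A hu]
      simp

/-- The Passman scheme of degree `|F|²`. -/
def passmanScheme (F : Type*) [Field F] [Finite F] : CoherentConfiguration (Fin 2 → F) :=
  CoherentConfiguration.inv (passmanGroup F)

/-! The Passman group preserves `((u 0 - v 0) * (u 1 - v 1)) ^ 2`, so this form is constant on the
basis relations of the extension. Fix a base point `u` and call a point determined if it is alone in
its class seen from `u`; it then acts as a landmark: two points in the same class from `u` have
equal forms to it. Points that were individualized are determined from every `u`.

Two individualized points are corners of an axis-parallel rectangle, and a third corner serves as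
`u`. The zeros of the form then fix the fourth corner (`determines_fourth_corner`). From four
corners the values of the form fix the points of two crossing sides, extended to full lines, and
from these lines every other point (`determines_of_corners`). -/

namespace CoherentConfiguration

/-! ### Determined points in a coherent configuration -/

variable {Ω : Type*} [Finite Ω]

/-- If `(α, β)` and `(α', β')` lie in the same basis relation, every path `α, γ, β` has a path
`α', γ', β'` of the same type. -/
theorem exists_path (Y : CoherentConfiguration Ω) {α β α' β' : Ω}
    (h : Y.setoid (α, β) (α', β')) (γ : Ω) :
    ∃ γ', Y.setoid (α, γ) (α', γ') ∧ Y.setoid (γ, β) (γ', β') := by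
  have cls : ∀ q, {x | Y.setoid x q} ∈ Y.basis := fun q => by
    rw [← Y.classes_setoid]
    exact ⟨q, rfl⟩
  have e := Y.coherent _ (cls (α, γ)) _ (cls (γ, β)) _ (cls (α, β)) (α, β) (Y.setoid.refl _)
    (α', β') (Y.setoid.symm h)
  have hne : 0 < (nbhd α {x | Y.setoid x (α, γ)} ∩
      nbhd β (conv {x | Y.setoid x (γ, β)})).ncard :=
    (Set.ncard_pos (Set.toFinite _)).2 ⟨γ, Y.setoid.refl _, Y.setoid.refl _⟩
  obtain ⟨γ', h1, h2⟩ := (Set.ncard_pos (Set.toFinite _)).1 (e ▸ hne)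
  exact ⟨γ', Y.setoid.symm h1, Y.setoid.symm h2⟩

theorem eq_iff_of_setoid (Y : CoherentConfiguration Ω) {α β α' β' : Ω}
    (h : Y.setoid (α, β) (α', β')) : α = β ↔ α' = β' := by
  have hm := (Y.mem_unions _).1 Y.diagonal_mem
  exact ⟨fun e => hm _ _ h e, fun e => hm _ _ (Y.setoid.symm h) e⟩

/-- The point `β` is determined by `α` if it is the only point in its basis relation
from `α`. -/
def Determines (Y : CoherentConfiguration Ω) (α β : Ω) : Prop :=
  ∀ γ, Y.setoid (α, β) (α, γ) → γ = β

theorem determines_self (Y : CoherentConfiguration Ω) (α : Ω) : Y.Determines α α :=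
  fun _ h => ((Y.eq_iff_of_setoid h).1 rfl).symm

/-- The path `α, β, β` must be matched by a path ending in `γ` whose last step lies in the class of
`(β, β)`, which is a singleton. -/
theorem determines_of_singleton (Y : CoherentConfiguration Ω) {β : Ω}
    (hβ : {(β, β)} ∈ unions Y.basis) (α : Ω) : Y.Determines α β := by
  intro γ h
  obtain ⟨δ, -, h2⟩ := Y.exists_path h β
  have := (Y.mem_unions _).1 hβ _ _ h2 rfl
  exact congrArg Prod.snd this

/-- A path `α, δ, β` can only be matched by one through `δ` itself. This makes determined points
usable as landmarks. -/
theorem Determines.setoid {Y : CoherentConfiguration Ω} {α δ : Ω} (hδ : Y.Determines α δ)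
    {β γ : Ω} (h : Y.setoid (α, β) (α, γ)) : Y.setoid (δ, β) (δ, γ) := by
  obtain ⟨δ', h1, h2⟩ := Y.exists_path h δ
  rwa [hδ δ' h1] at h2

theorem isPartlyRegular_of_determines (Y : CoherentConfiguration Ω) (α : Ω)
    (h : ∀ β, Y.Determines α β) : Y.IsPartlyRegular := by
  refine ⟨α, fun s hs => ?_⟩
  rw [← Y.classes_setoid] at hs
  obtain ⟨p, rfl⟩ := hs
  refine (Set.ncard_le_one (Set.toFinite _)).2 fun β hβ γ hγ => ?_
  exact h γ β (Y.setoid.trans hγ (Y.setoid.symm hβ))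

end CoherentConfiguration

/-! ### The invariant form and its values -/

open CoherentConfiguration

/-- The Passman form `(x y)²` of the difference of two points is an invariant of the
Passman group. -/
theorem passman_form_smul {F : Type*} [Field F] (g : passmanGroup F) (u v : Fin 2 → F) :
    (((g • u) 0 - (g • v) 0) * ((g • u) 1 - (g • v) 1)) ^ 2
      = ((u 0 - v 0) * (u 1 - v 1)) ^ 2 := by
  obtain ⟨g, A, b, hA, hd, hg⟩ := g
  have hsq : A.det ^ 2 = 1 := by rcases hd with h | h <;> simp [h]
  rw [Matrix.det_fin_two] at hsq
  have hu : ∀ w, (⟨g, A, b, hA, hd, hg⟩ : passmanGroup F) • w = A.mulVec w + b := hg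
  rw [hu, hu]
  simp only [Matrix.mulVec, dotProduct, Fin.sum_univ_two, Pi.add_apply]
  -- A diagonal or antidiagonal matrix multiplies the product of the two coordinates by `det A` or
  -- `-det A`.
  rcases (isMonomial_two_iff A).1 hA with ⟨h1, h2, -, -⟩ | ⟨h1, h2, -, -⟩ <;>
    rw [h1, h2] at hsq ⊢ <;> linear_combination ((u 0 - v 0) * (u 1 - v 1)) ^ 2 * hsq

theorem passman_form_eq_of_setoid {F : Type*} [Field F] [Finite F]
    {Y : CoherentConfiguration (Fin 2 → F)} (hY : (passmanScheme F).basis ⊆ unions Y.basis)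
    {u v u' v' : Fin 2 → F} (h : Y.setoid (u, v) (u', v')) :
    ((u' 0 - v' 0) * (u' 1 - v' 1)) ^ 2 = ((u 0 - v 0) * (u 1 - v 1)) ^ 2 := by
  have hm : MulAction.orbit (passmanGroup F) (u, v) ∈ unions Y.basis := hY ⟨(u, v), rfl⟩
  obtain ⟨g, hg⟩ := (Y.mem_unions _).1 hm _ _ h (MulAction.mem_orbit_self _)
  have h1 : g • u = u' := congrArg Prod.fst hg
  have h2 : g • v = v' := congrArg Prod.snd hg
  rw [← h1, ← h2, passman_form_smul]

/-- A number is determined by the squares of its differences from two distinct numbers. -/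
theorem eq_of_sq_sub_eq {F : Type*} [Field F] (h2 : (2 : F) ≠ 0) {a a' x x' : F} (ha : a ≠ a')
    (h : (a - x') ^ 2 = (a - x) ^ 2) (h' : (a' - x') ^ 2 = (a' - x) ^ 2) : x' = x := by
  have h3 : 2 * (a - a') ≠ 0 := mul_ne_zero h2 (sub_ne_zero.2 ha)
  apply mul_left_cancel₀ h3
  linear_combination h' - h

/-- If `t ↦ (t - x)² m²` and `t ↦ (t - x')² m'²` coincide and `m ≠ 0`, then `x' = x`. -/
theorem eq_of_forall_sq_eq {F : Type*} [Field F] {x x' m m' : F}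
    (hm : m ≠ 0) (h : ∀ t, ((t - x') * m') ^ 2 = ((t - x) * m) ^ 2) : x' = x := by
  have hx := h x
  have hmm : m' ≠ 0 := by
    rintro rfl
    -- With `m' = 0`, the value at `x + 1` is `m ^ 2` on one side and zero on the other.
    have h3 := h (x + 1)
    apply hm
    rw [← sq_eq_zero_iff]
    linear_combination -h3
  rw [sub_self, zero_mul, zero_pow two_ne_zero, sq_eq_zero_iff, mul_eq_zero] at hx
  exact (sub_eq_zero.1 (hx.resolve_right hmm)).symm

/-! ### Rectangles with determined corners -/

section Rectangle

variable {F : Type*} [Field F] [Finite F] {Y : CoherentConfiguration (Fin 2 → F)}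
  {u : Fin 2 → F}

/-- The form vanishes exactly when a coordinate is shared. Only two points share a coordinate with
both neighbouring corners: the fourth corner and the first one, which is excluded because it is
determined. -/
theorem determines_fourth_corner (hY : (passmanScheme F).basis ⊆ unions Y.basis)
    {s s' t t' : F} (hs : s ≠ s') (ht : t ≠ t') (h : Y.Determines u ![s, t])
    (h₁ : Y.Determines u ![s', t]) (h₂ : Y.Determines u ![s, t']) :
    Y.Determines u ![s', t'] := by
  intro v hv
  have e1 := passman_form_eq_of_setoid hY (h₁.setoid hv)
  have e2 := passman_form_eq_of_setoid hY (h₂.setoid hv)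
  have e3 : ![s, t] ≠ v := fun e => by
    have := (Y.eq_iff_of_setoid (h.setoid hv)).2 e
    exact hs (congrFun this 0)
  simp only [Matrix.cons_val_zero, Matrix.cons_val_one, sub_self, zero_mul, mul_zero, ne_eq,
    OfNat.ofNat_ne_zero, not_false_eq_true, zero_pow, sq_eq_zero_iff, mul_eq_zero,
    sub_eq_zero] at e1 e2
  have key : s' = v 0 ∧ t' = v 1 := by
    have : ¬ (s = v 0 ∧ t = v 1) := fun e => e3 (by ext i; fin_cases i <;> simp [e.1, e.2])
    grind
  ext i
  fin_cases i <;> simp [key.1, key.2]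

/-- The corners give the lines through `![a, b]`; each line then locates the points off it. -/
theorem determines_of_corners (h2 : (2 : F) ≠ 0)
    (hY : (passmanScheme F).basis ⊆ unions Y.basis) {a a' b b' : F} (ha : a ≠ a') (hb : b ≠ b')
    (h₁ : Y.Determines u ![a, b]) (h₂ : Y.Determines u ![a', b])
    (h₃ : Y.Determines u ![a, b']) (h₄ : Y.Determines u ![a', b']) (v : Fin 2 → F) :
    Y.Determines u v := by
  have hor : ∀ x, Y.Determines u ![x, b] := by
    intro x w hw
    have e1 := passman_form_eq_of_setoid hY (h₁.setoid hw)
    have e2 := passman_form_eq_of_setoid hY (h₂.setoid hw)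
    have e3 := passman_form_eq_of_setoid hY (h₃.setoid hw)
    have e4 := passman_form_eq_of_setoid hY (h₄.setoid hw)
    simp only [Matrix.cons_val_zero, Matrix.cons_val_one] at e1 e2 e3 e4
    -- Otherwise both zeros of the form would force `w 0 = a` and `w 0 = a'`.
    have hw1 : w 1 = b := by
      simp only [sub_self, mul_zero, ne_eq, OfNat.ofNat_ne_zero, not_false_eq_true, zero_pow,
        sq_eq_zero_iff, mul_eq_zero, sub_eq_zero] at e1 e2
      grind
    have hbb : (b' - b) ^ 2 ≠ 0 := pow_ne_zero _ (sub_ne_zero.2 hb.symm)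
    -- From the opposite side, cancelling `(b' - b) ^ 2` leaves the squared differences of `w 0`
    -- from `a` and `a'`.
    rw [hw1, mul_pow, mul_pow] at e3 e4
    have hw0 := eq_of_sq_sub_eq h2 ha (mul_right_cancel₀ hbb e3) (mul_right_cancel₀ hbb e4)
    ext i
    fin_cases i <;> simp [hw0, hw1]
  have ver : ∀ y, Y.Determines u ![a, y] := by
    intro y w hw
    have e1 := passman_form_eq_of_setoid hY (h₁.setoid hw)
    have e2 := passman_form_eq_of_setoid hY (h₂.setoid hw)
    have e3 := passman_form_eq_of_setoid hY (h₃.setoid hw)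
    have e4 := passman_form_eq_of_setoid hY (h₄.setoid hw)
    simp only [Matrix.cons_val_zero, Matrix.cons_val_one] at e1 e2 e3 e4
    have hw0 : w 0 = a := by
      simp only [sub_self, zero_mul, ne_eq, OfNat.ofNat_ne_zero, not_false_eq_true, zero_pow,
        sq_eq_zero_iff, mul_eq_zero, sub_eq_zero] at e1 e3
      grind
    have haa : (a' - a) ^ 2 ≠ 0 := pow_ne_zero _ (sub_ne_zero.2 ha.symm)
    rw [hw0, mul_pow, mul_pow] at e2 e4
    have hw1 := eq_of_sq_sub_eq h2 hb (mul_left_cancel₀ haa e2) (mul_left_cancel₀ haa e4)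
    ext i
    fin_cases i <;> simp [hw0, hw1]
  have hv : v = ![v 0, v 1] := by ext i; fin_cases i <;> rfl
  by_cases h0 : v 0 = a
  · rw [hv, h0]
    exact ver _
  by_cases h1 : v 1 = b
  · rw [hv, h1]
    exact hor _
  intro w hw
  -- Seen from the points `![t, b]`, the form vanishes only at `t = v 0`, since `v 1 ≠ b`.
  have e0 : w 0 = v 0 := by
    refine eq_of_forall_sq_eq (m := b - v 1) (m' := b - w 1) (sub_ne_zero.2 (Ne.symm h1)) ?_
    intro t
    simpa using passman_form_eq_of_setoid hY ((hor t).setoid hw)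
  have e1 : w 1 = v 1 := by
    refine eq_of_forall_sq_eq (m := a - v 0) (m' := a - w 0) (sub_ne_zero.2 (Ne.symm h0)) ?_
    intro t
    simpa [mul_comm] using passman_form_eq_of_setoid hY ((ver t).setoid hw)
  ext i
  fin_cases i
  exacts [e0, e1]

end Rectangle

/-! ### Choice of the base point -/

/-- The points `α` and `β` can be completed to an axis-parallel rectangle whose third corner
determines all points. -/
theorem isPartlyRegular_of_two_points {F : Type*} [Field F] [Finite F] (h2 : (2 : F) ≠ 0)
    {Y : CoherentConfiguration (Fin 2 → F)} (hY : (passmanScheme F).basis ⊆ unions Y.basis)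
    {α β : Fin 2 → F} (hne : α ≠ β) (hα : {(α, α)} ∈ unions Y.basis)
    (hβ : {(β, β)} ∈ unions Y.basis) : Y.IsPartlyRegular := by
  have hv : ∀ v : Fin 2 → F, v = ![v 0, v 1] := fun v => by ext i; fin_cases i <;> rfl
  have dα := Y.determines_of_singleton hα
  have dβ := Y.determines_of_singleton hβ
  have succ_ne : ∀ t : F, t ≠ t + 1 := fun t => by simp
  rw [hv α] at dα
  rw [hv β] at dβ
  by_cases h0 : α 0 = β 0
  · have h1 : α 1 ≠ β 1 := fun h1 => hne (by rw [hv α, hv β, h0, h1])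
    rw [← h0] at dβ
    -- Here `α` and `β` span a side, and any shift off their line gives a third corner.
    have hu := Y.determines_self ![α 0 + 1, α 1]
    exact Y.isPartlyRegular_of_determines _ (determines_of_corners h2 hY (succ_ne (α 0)) h1
      (dα _) hu (dβ _) (determines_fourth_corner hY (succ_ne _) h1 (dα _) hu (dβ _)))
  by_cases h1 : α 1 = β 1
  · rw [← h1] at dβ
    have hu := Y.determines_self ![α 0, α 1 + 1]
    exact Y.isPartlyRegular_of_determines _ (determines_of_corners h2 hY h0 (succ_ne (α 1))
      (dα _) (dβ _) hu (determines_fourth_corner hY h0 (succ_ne _) (dα _) (dβ _) hu))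
  -- Now `α` and `β` are opposite corners, and the base point is one of the other two.
  have hu := Y.determines_self ![β 0, α 1]
  exact Y.isPartlyRegular_of_determines _ (determines_of_corners h2 hY h0 h1
    (dα _) hu (determines_fourth_corner hY (Ne.symm h0) h1 hu (dα _) (dβ _)) (dβ _))

theorem theorem5p5 (q : ℕ) (hq : IsPrimePow q) (hodd : Odd q)
    (F : Type*) [Field F] [Finite F] (hF : Nat.card F = q)
    (A : Set (Fin 2 → F)) (hA : 2 ≤ A.ncard) :
    ((passmanScheme F).pointExtension A).IsPartlyRegular := by
  have h2 : (2 : F) ≠ 0 := by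
    have := Fintype.ofFinite F
    apply Ring.two_ne_zero
    rw [Ne, FiniteField.even_card_iff_char_two, ← Nat.card_eq_fintype_card, hF,
      ← Nat.even_iff, Nat.not_even_iff_odd]
    exact hodd
  obtain ⟨α, β, hα, hβ, hne⟩ := (Set.one_lt_ncard_iff (Set.toFinite A)).1 hA
  have hT := (isLeast_WL ((passmanScheme F).basis ∪ {r | ∃ α ∈ A, r = {(α, α)}})).1
  exact isPartlyRegular_of_two_points h2 (fun r hr => hT (Or.inl hr)) hne
    (hT (Or.inr ⟨α, hα, rfl⟩)) (hT (Or.inr ⟨β, hβ, rfl⟩))
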